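/- **Theorem (Poisson Mixture Process).** Let $\Omega$ be a measurable space, $G_0$ a finite measure on $\Omega$, and $\rho$ a measure on $(0,\infty)$ with $\int_0^\infty \min\{1,r\}\,\rho(dr)<\infty$. A random measure $G$ on $\Omega$ with $G(\Omega)<\infty$ almost surely is called a completely random measure with Lévy measure $\nu$, where $\nu$ is a measure on $(0,\infty)\times\Omega$ with $\iint\min\{1,r\}\,\nu(dr\,d\omega)<\infty$, if for pairwise disjoint measurable sets $A_1,\dots,A_N\subset\Omega$ the variables $G(A_1),\dots,G(A_N)$ are independent, and $\mathbb{E}[e^{iuG(A)}]=\exp\big\{\iint_{(0,\infty)\times A}(e^{iur}-1)\,\nu(dr\,d\omega)\big\}$ for every measurable $A\subset\Omega$ and $u\in\mathbb{R}$. Let $G=\sum_{k=1}^{K} r_k\delta_{\omega_k}$ (with a random number $K\le\infty$ of atoms, random weights $r_k\ge 0$ and random locations $\omega_k\in\Omega$) be a completely random measure with Lévy measure $\nu(dr\,d\omega)=\rho(dr)\,G_0(d\omega)$. Conditionally on $(K,(r_k)_k,(\omega_k)_k)$, let the counts $n_k$, $k\le K$, be independent with $n_k\sim\mathrm{Pois}(r_k)$,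 and let $X:=\sum_{k=1}^{K} n_k\delta_{\omega_k}$. Then: 1. $X$ is a $G$-mixed Poisson process: conditionally on $G$, for pairwise disjoint measurable sets $A_1,\dots,A_N$ the variables $X(A_1),\dots,X(A_N)$ are independent with $X(A_i)\sim\mathrm{Pois}(G(A_i))$. 2. With $G$ marginalized out, for every measurable $A\subset\Omega$ and $u\in\mathbb{R}$, $$\mathbb{E}\big[e^{iuX(A)}\big]=\exp\Big\{G_0(A)\sum_{n=1}^\infty (e^{iun}-1)\int_0^\infty \frac{r^n e^{-r}}{n!}\,\rho(dr)\Big\},$$ where all the integrals are finite and the series converges absolutely. 3. With $G$ marginalized out, $X$ is a completely random measure with Lévy measure $$\tilde\nu(dn\,d\omega)=\sum_{j=1}^\infty \int_0^\infty \frac{r^j e^{-r}}{j!}\,\rho(dr)\;\delta_j(dn)\,G_0(d\omega).$$ -/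

import Mathlib

open MeasureTheory ProbabilityTheory Set
open scoped ENNReal NNReal

noncomputable section

namespace CountMixture

/-- `ν` on `ℝ × Ω` is a Lévy measure (for a nonnegative random measure without drift): it is
carried by positive jump sizes, and `∫∫ min{1, r} ν(dr dω) < ∞`. -/
structure IsLevyMeasure {Ω : Type*} [MeasurableSpace Ω] (ν : Measure (ℝ × Ω)) : Prop where
  null_nonpos : ν (Iic 0 ×ˢ univ) = 0
  lintegral_min_lt_top : ∫⁻ p, ENNReal.ofReal (min 1 p.1) ∂ν < ∞

/-- The random measure `G` on `Ω` is a completely random measure with finite total mass and with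
Lévy measure `ν`: it gives independent values to disjoint sets, and
`E[exp(iuG(A))] = exp(∫∫_{ℝ₊ × A} (exp(iur) - 1) ν(dr dω))`. -/
structure IsCompletelyRandomMeasure {S Ω : Type*} [MeasurableSpace S] [MeasurableSpace Ω]
    (P : Measure S) (G : S → Measure Ω) (ν : Measure (ℝ × Ω)) : Prop where
  measurable : Measurable G
  ae_finite : ∀ᵐ s ∂P, G s univ < ∞
  isLevyMeasure : IsLevyMeasure ν
  indep : ∀ (N : ℕ) (A : Fin N → Set Ω), (∀ i, MeasurableSet (A i)) →
    Pairwise (fun i j => Disjoint (A i) (A j)) → iIndepFun (fun i s => G s (A i)) P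
  charFun_eq : ∀ A : Set Ω, MeasurableSet A → ∀ u : ℝ,
    ∫ s, Complex.exp (Complex.I * u * (G s A).toReal) ∂P =
      Complex.exp (∫ p in univ ×ˢ A, (Complex.exp (Complex.I * u * p.1) - 1) ∂ν)

/-- `X` is a mixed Poisson process directed by the random measure `G`: conditionally on `G`, it is
a Poisson process with mean measure `G`, that is, the values of `X` on disjoint sets `A i` are
independent and Poisson distributed with means `G (A i)`. -/
structure IsMixedPoissonProcess {S Ω : Type*} [MeasurableSpace S] [MeasurableSpace Ω]
    (P : Measure S) (G X : S → Measure Ω) : Prop where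
  measurable_directing : Measurable G
  measurable : Measurable X
  ae_finite_directing : ∀ᵐ s ∂P, G s univ < ∞
  cond_poisson : ∀ (N : ℕ) (A : Fin N → Set Ω), (∀ i, MeasurableSet (A i)) →
    Pairwise (fun i j => Disjoint (A i) (A j)) → ∀ j : Fin N → ℕ,
      P⟦{s | ∀ i, X s (A i) = (j i : ℝ≥0∞)} | MeasurableSpace.comap G inferInstance⟧ =ᵐ[P]
        fun s => ∏ i, (poissonMeasure (G s (A i)).toNNReal).real {j i}

/-- The random measure `∑_{k < K} w_k δ_{ω_k}`, with `K ≤ ∞` atoms (numbered from `0`). -/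
def atomicMeasure {S Ω : Type*} [MeasurableSpace Ω]
    (K : S → ℕ∞) (w : ℕ → S → ℝ≥0) (ω : ℕ → S → Ω) (s : S) : Measure Ω :=
  Measure.sum fun k : ℕ =>
    (if (k : ℕ∞) < K s then (w k s : ℝ≥0∞) else 0) • Measure.dirac (ω k s)

/-- The σ-algebra generated by the number `K`, the weights `r_k` and the locations `ω_k` of the
atoms. -/
abbrev atomSigma {S Ω : Type*} [MeasurableSpace Ω]
    (K : S → ℕ∞) (r : ℕ → S → ℝ≥0) (ω : ℕ → S → Ω) : MeasurableSpace S :=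
  MeasurableSpace.comap (fun s => (K s, (fun k => r k s), (fun k => ω k s))) inferInstance

/-- The count-mixture model: `G = ∑_{k < K} r_k δ_{ω_k}` is a homogeneous completely random
measure with Lévy measure `ρ(dr) G₀(dω)`, and, given the atoms of `G`, the counts `n_k`, `k < K`,
are independent with `n_k ∼ Pois(r_k)`. Indices `k ≥ K` carry weight `0` and count `0`. -/
structure IsCountMixture {S Ω : Type*} [MeasurableSpace S] [MeasurableSpace Ω]
    (P : Measure S) (ρ : Measure ℝ) (G₀ : Measure Ω)
    (K : S → ℕ∞) (r : ℕ → S → ℝ≥0) (ω : ℕ → S → Ω) (n : ℕ → S → ℕ) : Prop where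
  measurable_K : Measurable K
  measurable_r : ∀ k, Measurable (r k)
  measurable_ω : ∀ k, Measurable (ω k)
  measurable_n : ∀ k, Measurable (n k)
  crm : IsCompletelyRandomMeasure P (atomicMeasure K r ω) (ρ.prod G₀)
  cond_counts : ∀ (N : ℕ) (j : Fin N → ℕ),
    P⟦{s | ∀ i : Fin N, (if ((i : ℕ) : ℕ∞) < K s then n i s else 0) = j i} | atomSigma K r ω⟧
      =ᵐ[P] fun s =>
        ∏ i : Fin N, (poissonMeasure (if ((i : ℕ) : ℕ∞) < K s then r i s else 0)).real {j i}

/-- The measure `∑_{j ≥ 1} (∫ r^j e^{-r} / j! ρ(dr)) δ_j(dn) G₀(dω)` on `ℝ × Ω`. -/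
def mixtureLevyMeasure {Ω : Type*} [MeasurableSpace Ω] (ρ : Measure ℝ) (G₀ : Measure Ω) :
    Measure (ℝ × Ω) :=
  Measure.sum fun m : ℕ =>
    (∫⁻ r in Ioi 0, ENNReal.ofReal (r ^ (m + 1) * Real.exp (-r) / (m + 1).factorial) ∂ρ) •
      (Measure.dirac ((m + 1 : ℕ) : ℝ)).prod G₀

end CountMixture

end

/-!
Given the atoms of `G`, the counts form a sequence of independent Poisson variables. Disjoint sets
`A i` select disjoint blocks of atoms, and a sum of independent Poisson variables over a block is
Poisson with the sum of the rates, `G (A i)`, as its rate. The law obtained depends on the atoms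
only through `G`, so it is also the conditional law given `G`.

The rest holds for every mixed Poisson process `X` directed by a completely random measure `G`.
Averaging the Poisson characteristic function expresses `E exp (iuX(A))` as the Laplace transform
of `G(A)` at the complex point `1 - exp (iu)`. The hypothesis on `G` only gives this transform on
the imaginary axis, but both it and `exp ∫∫ (exp (-zr) - 1)` are bounded and continuous on the
closed right half plane and holomorphic inside, so by Phragmén–Lindelöf they agree there. At
`z = 1 - exp (iu)` the integrand is `exp (-r) * ∑ (exp (iun) - 1) * r ^ n / n!`.
-/

namespace CountMixture

open Filter Topology

section PoissonSums

lemma eq_map_of_forall_singleton {α β : Type*} [Countable α] [MeasurableSpace α]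
    [MeasurableSpace β] [MeasurableSingletonClass β] {μ : Measure β} [IsProbabilityMeasure μ]
    {ν : Measure α} [IsProbabilityMeasure ν] {f : α → β} (hf : Measurable f)
    (hinj : Function.Injective f) (h : ∀ a, μ {f a} = ν {a}) : μ = ν.map f := by
  have := Measure.isProbabilityMeasure_map (μ := ν) hf.aemeasurable
  refine (Measure.eq_of_le_of_isProbabilityMeasure (Measure.le_iff.2 fun s hs => ?_)).symm
  have hcount : (s ∩ range f).Countable := (countable_range f).mono inter_subset_right
  calc ν.map f s = ν.map f (s ∩ range f) := by
        rw [Measure.map_apply hf hs, Measure.map_apply hf hcount.measurableSet,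
          preimage_inter_range]
    _ = ∑' b : ↥(s ∩ range f), ν.map f {b.1} :=
        (tsum_measure_preimage_singleton (f := id) hcount fun b _ => measurableSet_singleton b).symm
    _ = ∑' b : ↥(s ∩ range f), μ {b.1} := by
        refine tsum_congr fun ⟨b, _, a, hab⟩ => ?_
        have hpre : f ⁻¹' {b} = {a} := by ext x; simp [← hab, hinj.eq_iff]
        rw [Measure.map_apply hf (measurableSet_singleton _), hpre, ← h, hab]
    _ = μ (s ∩ range f) :=
        tsum_measure_preimage_singleton (f := id) hcount fun b _ => measurableSet_singleton b
    _ ≤ μ s := measure_mono inter_subset_left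

lemma poissonMeasure_zero : poissonMeasure 0 = Measure.dirac 0 := by
  refine Measure.ext_of_singleton fun a => ?_
  rw [poissonMeasure_singleton]
  rcases Nat.eq_zero_or_pos a with rfl | ha
  · simp
  · rw [Measure.dirac_apply' _ (measurableSet_singleton a)]
    simp [ha.ne', ha.ne]

lemma continuous_poissonMeasure_singleton (j : ℕ) :
    Continuous fun c : ℝ≥0 => poissonMeasure c {j} := by
  simp only [poissonMeasure_singleton]
  exact ENNReal.continuous_ofReal.comp (by fun_prop)

lemma eventually_sum_eq_iff_tsum_eq {ι : Type*} (a : ι → ℕ) (m : ℕ) :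
    ∀ᶠ s : Finset ι in atTop, (∑ k ∈ s, a k = m ↔ ∑' k, (a k : ℝ≥0∞) = m) := by
  have htendsto : Tendsto (fun s : Finset ι => ((∑ k ∈ s, a k : ℕ) : ℝ≥0∞)) atTop
      (𝓝 (∑' k, (a k : ℝ≥0∞))) := by
    simpa only [Nat.cast_sum, HasSum, SummationFilter.unconditional_filter] using
      (ENNReal.summable (f := fun k => (a k : ℝ≥0∞))).hasSum
  by_cases h : ∑' k, (a k : ℝ≥0∞) = m
  · have hnat : Tendsto (fun s : Finset ι => ∑ k ∈ s, a k) atTop (𝓝 m) := by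
      rw [h] at htendsto
      rw [Nat.isClosedEmbedding_coe_real.isEmbedding.tendsto_nhds_iff]
      simpa only [Function.comp_def, ENNReal.toReal_natCast] using
        (ENNReal.tendsto_toReal (ENNReal.natCast_ne_top m)).comp htendsto
    rw [nhds_discrete, tendsto_pure] at hnat
    filter_upwards [hnat] with s hs
    simp only [hs, h]
  · filter_upwards [htendsto.eventually_ne h] with s hs
    simp only [h, iff_false]
    exact fun hsum => hs (by rw [hsum])

variable {Ξ ι : Type*} [MeasurableSpace Ξ] {μ : Measure Ξ} [IsProbabilityMeasure μ]
  {f : ι → Ξ → ℕ} {c : ι → ℝ≥0}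

lemma hasLaw_sum_poissonMeasure (hf : ∀ k, Measurable (f k)) (hind : iIndepFun f μ)
    (hlaw : ∀ k, HasLaw (f k) (poissonMeasure (c k)) μ) (s : Finset ι) :
    HasLaw (∑ k ∈ s, f k) (poissonMeasure (∑ k ∈ s, c k)) μ := by
  classical
  induction s using Finset.induction_on with
  | empty =>
    refine ⟨by fun_prop, ?_⟩
    rw [Finset.sum_empty, Finset.sum_empty, poissonMeasure_zero]
    change μ.map (fun _ => 0) = _
    rw [Measure.map_const, measure_univ, one_smul]
  | insert a s ha ih =>
    rw [Finset.sum_insert ha, Finset.sum_insert ha, add_comm (f a), add_comm (c a)]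
    exact (hind.indepFun_finsetSum_of_notMem hf ha).hasLaw_add_poissonMeasure ih (hlaw a)

lemma hasLaw_tsum_poissonMeasure [Countable ι] (hf : ∀ k, Measurable (f k)) (hind : iIndepFun f μ)
    (hlaw : ∀ k, HasLaw (f k) (poissonMeasure (c k)) μ) (hc : Summable c) :
    HasLaw (fun x => ∑' k, (f k x : ℝ≥0∞))
      ((poissonMeasure (∑' k, c k)).map (Nat.cast : ℕ → ℝ≥0∞)) μ := by
  have hmeas : Measurable fun x => ∑' k, (f k x : ℝ≥0∞) := by fun_prop
  have := Measure.isProbabilityMeasure_map (μ := μ) hmeas.aemeasurable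
  refine ⟨hmeas.aemeasurable,
    eq_map_of_forall_singleton .of_discrete Nat.cast_injective fun m => ?_⟩
  rw [Measure.map_apply hmeas (measurableSet_singleton _)]
  have hpartial (s : Finset ι) :
      μ {x | ∑ k ∈ s, f k x = m} = poissonMeasure (∑ k ∈ s, c k) {m} := by
    rw [← (hasLaw_sum_poissonMeasure hf hind hlaw s).map_eq,
      Measure.map_apply (by fun_prop) (measurableSet_singleton _)]
    simp [preimage]
  refine tendsto_nhds_unique (f := fun s => μ {x | ∑ k ∈ s, f k x = m}) (l := atTop) ?_ ?_
  · refine tendsto_measure_of_ae_tendsto_indicator_of_isFiniteMeasure atTop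
      (hmeas (measurableSet_singleton _)) (fun s => ?_) (Eventually.of_forall fun x => ?_)
    · exact (Finset.measurable_sum s fun k _ => hf k) (measurableSet_singleton m)
    · exact eventually_sum_eq_iff_tsum_eq (fun k => f k x) m
  · simp only [hpartial]
    exact ((continuous_poissonMeasure_singleton m).tendsto _).comp hc.hasSum

lemma iIndepFun_curry {κ : Type*} {β : κ → Type*} {E : (i : κ) → β i → Type*}
    [∀ i k, MeasurableSpace (E i k)] {g : (i : κ) → (k : β i) → Ξ → E i k}
    (hg : ∀ i k, Measurable (g i k)) (hind : iIndepFun (fun p : (i : κ) × β i => g p.1 p.2) μ) :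
    iIndepFun (fun i x k => g i k x) μ := by
  have hprob (i k) : IsProbabilityMeasure (μ.map (g i k)) :=
    Measure.isProbabilityMeasure_map (hg i k).aemeasurable
  have hsection (i : κ) : iIndepFun (g i) μ := hind.precomp (g := Sigma.mk i) sigma_mk_injective
  rw [iIndepFun_iff_map_fun_eq_infinitePi_map fun i => by fun_prop]
  calc μ.map (fun x i k => g i k x)
      = (μ.map fun x (p : (i : κ) × β i) => g p.1 p.2 x).map (MeasurableEquiv.piCurry E) := by
        rw [Measure.map_map (by fun_prop) (by fun_prop)]; rfl
    _ = Measure.infinitePi fun i => Measure.infinitePi fun k => μ.map (g i k) := by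
        rw [hind.map_fun_eq_infinitePi_map fun p => hg p.1 p.2]
        exact Measure.infinitePi_map_piCurry fun i k => μ.map (g i k)
    _ = Measure.infinitePi fun i => μ.map fun x k => g i k x := by
        congr! 2 with i
        exact ((hsection i).map_fun_eq_infinitePi_map (hg i)).symm

lemma iIndepFun_restrict_of_pairwise_disjoint {κ : Type*} {D : κ → Set ι}
    (hf : ∀ k, Measurable (f k)) (hind : iIndepFun f μ)
    (hD : Pairwise fun i j => Disjoint (D i) (D j)) :
    iIndepFun (fun i x (k : D i) => f k x) μ := by
  refine iIndepFun_curry (g := fun i (k : D i) => f k) (fun i k => hf k)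
    (hind.precomp (g := fun p : (i : κ) × D i => (p.2 : ι)) ?_)
  rintro ⟨i, k, hk⟩ ⟨j, l, hl⟩ (rfl : k = l)
  obtain rfl : i = j := by_contra fun hij => disjoint_left.1 (hD hij) hk hl
  rfl

lemma measure_forall_tsum_eq_prod_poissonMeasure [Countable ι] {κ : Type*} [Fintype κ]
    (hf : ∀ k, Measurable (f k)) (hind : iIndepFun f μ)
    (hlaw : ∀ k, HasLaw (f k) (poissonMeasure (c k)) μ) {D : κ → Set ι}
    (hD : Pairwise fun i j => Disjoint (D i) (D j)) (hc : ∀ i, Summable fun k : D i => c k)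
    (j : κ → ℕ) :
    μ {x | ∀ i, ∑' k : D i, (f k x : ℝ≥0∞) = j i} =
      ∏ i, poissonMeasure (∑' k : D i, c k) {j i} := by
  have hblocks : iIndepFun (fun i x => ∑' k : D i, (f k x : ℝ≥0∞)) μ :=
    (iIndepFun_restrict_of_pairwise_disjoint hf hind hD).comp
      (fun i v => ∑' k : D i, (v k : ℝ≥0∞)) fun i => by fun_prop
  have hsum (i : κ) : HasLaw (fun x => ∑' k : D i, (f k x : ℝ≥0∞)) _ μ :=
    hasLaw_tsum_poissonMeasure (fun k : D i => hf k)
      (hind.precomp Subtype.val_injective) (fun k => hlaw k) (hc i)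
  have hinter : {x | ∀ i, ∑' k : D i, (f k x : ℝ≥0∞) = j i} =
      ⋂ i, (fun x => ∑' k : D i, (f k x : ℝ≥0∞)) ⁻¹' {(j i : ℝ≥0∞)} := by ext; simp
  rw [hinter, hblocks.meas_iInter fun i => ⟨{(j i : ℝ≥0∞)}, measurableSet_singleton _, rfl⟩]
  refine Finset.prod_congr rfl fun i _ => ?_
  have hcast : (Nat.cast : ℕ → ℝ≥0∞) ⁻¹' {(j i : ℝ≥0∞)} = {j i} := by ext; simp
  rw [← Measure.map_apply_of_aemeasurable (hsum i).aemeasurable (measurableSet_singleton _),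
    (hsum i).map_eq, Measure.map_apply .of_discrete (measurableSet_singleton _), hcast]

lemma infinitePi_poissonMeasure_forall_tsum_eq [Countable ι] {κ : Type*} [Fintype κ]
    {D : κ → Set ι} (hD : Pairwise fun i j => Disjoint (D i) (D j))
    (hc : ∀ i, ∑' k : D i, (c k : ℝ≥0∞) ≠ ∞) (j : κ → ℕ) :
    Measure.infinitePi (fun k => poissonMeasure (c k)) {v | ∀ i, ∑' k : D i, (v k : ℝ≥0∞) = j i} =
      ∏ i, poissonMeasure (∑' k : D i, (c k : ℝ≥0∞)).toNNReal {j i} := by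
  simp only [ENNReal.tsum_toNNReal_eq fun _ => ENNReal.coe_ne_top, ENNReal.toNNReal_coe]
  exact measure_forall_tsum_eq_prod_poissonMeasure (fun k => measurable_pi_apply k)
    (iIndepFun_infinitePi (X := fun _ => id) fun _ => measurable_id)
    (fun k => (measurePreserving_eval_infinitePi (fun k => poissonMeasure (c k)) k).hasLaw) hD
    (fun i => ENNReal.tsum_coe_ne_top_iff_summable.1 (hc i)) j

end PoissonSums

section ConditionalLaw

lemma ext_of_forall_measure_initial_eq {E : Type*} [Countable E] [MeasurableSpace E]
    [MeasurableSingletonClass E] {μ ν : Measure (ℕ → E)} [IsFiniteMeasure ν]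
    (h : ∀ (N : ℕ) (w : Fin N → E),
      μ {v | ∀ i : Fin N, v i = w i} = ν {v | ∀ i : Fin N, v i = w i}) : μ = ν := by
  have hfamily := isProjectiveMeasureFamily_map_restrict (P := ν) (X := fun k (v : ℕ → E) => v k)
    fun k => (measurable_pi_apply k).aemeasurable
  have hμ := (isProjectiveLimit_nat_iff hfamily μ).2 fun n => by
    refine Measure.ext_of_singleton fun w => ?_
    have hpre : Preorder.frestrictLe (π := fun _ => E) n ⁻¹' {w} =
        {v | ∀ i : Fin (n + 1), v i = w ⟨i, Finset.mem_Iic.2 (Nat.lt_succ_iff.1 i.2)⟩} := by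
      ext v
      simp only [mem_preimage, mem_singleton_iff, funext_iff, Subtype.forall, mem_ofPred_eq,
        Fin.forall_iff, Finset.mem_Iic, Nat.lt_succ_iff]
      rfl
    change _ = ν.map (Preorder.frestrictLe n) {w}
    rw [Measure.map_apply (by fun_prop) (measurableSet_singleton w),
      Measure.map_apply (by fun_prop) (measurableSet_singleton w), hpre, h]
  exact hμ.unique fun I => rfl

lemma condExp_ae_eq_of_le {S : Type*} {m₁ m₂ mS : MeasurableSpace S} {P : Measure S}
    [IsFiniteMeasure P] {f g : S → ℝ} (hm₁₂ : m₁ ≤ m₂) (hm₂ : m₂ ≤ mS) (hg : Measurable[m₁] g)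
    (hfg : P[f | m₂] =ᵐ[P] g) : P[f | m₁] =ᵐ[P] g :=
  calc P[f | m₁] =ᵐ[P] P[P[f | m₂] | m₁] := (condExp_condExp_of_le hm₁₂ hm₂).symm
    _ =ᵐ[P] P[g | m₁] := condExp_congr_ae hfg
    _ = g := condExp_of_stronglyMeasurable (hm₁₂.trans hm₂) hg.stronglyMeasurable
        (integrable_condExp.congr hfg)

variable {S T E : Type*} [MeasurableSpace S] [MeasurableSpace T] [MeasurableSpace E]
  {P : Measure S} [IsFiniteMeasure P] {Z : S → T}

lemma condDistrib_ae_eq_of_forall_initial [Countable E] [StandardBorelSpace E] [Nonempty E]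
    {y : S → ℕ → E} {ν : S → Measure (ℕ → E)} [∀ s, IsFiniteMeasure (ν s)] (hZ : Measurable Z)
    (hy : Measurable y)
    (h : ∀ (N : ℕ) (w : Fin N → E),
      P⟦{s | ∀ i : Fin N, y s i = w i} | MeasurableSpace.comap Z inferInstance⟧ =ᵐ[P]
        fun s => (ν s).real {v | ∀ i : Fin N, v i = w i}) :
    ∀ᵐ s ∂P, condDistrib y Z P (Z s) = ν s := by
  have hinitial : ∀ᵐ s ∂P, ∀ (N : ℕ) (w : Fin N → E),
      (condDistrib y Z P (Z s)).real {v | ∀ i : Fin N, v i = w i} =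
        (ν s).real {v | ∀ i : Fin N, v i = w i} := by
    refine ae_all_iff.2 fun N => ae_all_iff.2 fun w => ?_
    have heval (k : ℕ) : Measurable fun v : ℕ → E => v k := measurable_pi_apply k
    have hmeas : MeasurableSet {v : ℕ → E | ∀ i : Fin N, v i = w i} := by
      rw [ofPred_forall]
      exact MeasurableSet.iInter fun i => heval i (measurableSet_singleton (w i))
    exact (condDistrib_ae_eq_condExp hZ hy hmeas).trans (h N w)
  filter_upwards [hinitial] with s hs
  exact ext_of_forall_measure_initial_eq fun N w =>
    (measureReal_eq_measureReal_iff (by finiteness) (by finiteness)).1 (hs N w)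

lemma condExp_prodMk_mem_ae_eq_condDistrib [StandardBorelSpace E] [Nonempty E] {y : S → E}
    (hZ : Measurable Z) (hy : Measurable y) {F : Set (T × E)} (hF : MeasurableSet F) :
    P⟦{s | (Z s, y s) ∈ F} | MeasurableSpace.comap Z inferInstance⟧ =ᵐ[P]
      fun s => (condDistrib y Z P (Z s)).real {e | (Z s, e) ∈ F} := by
  have h := condExp_prod_ae_eq_integral_condDistrib (μ := P) hZ hy.aemeasurable
    (f := F.indicator fun _ => (1 : ℝ)) (stronglyMeasurable_one.indicator hF)
    ((integrable_const 1).indicator (hZ.prodMk hy hF))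
  refine h.trans (Eventually.of_forall fun s => ?_)
  exact integral_indicator_one (measurable_prodMk_left hF)

end ConditionalLaw

section Model

lemma infinitePi_forall_initial_eq {E : Type*} [MeasurableSpace E] [MeasurableSingletonClass E]
    (μ : ℕ → Measure E) [∀ k, IsProbabilityMeasure (μ k)] (N : ℕ) (w : Fin N → E) :
    Measure.infinitePi μ {v | ∀ i : Fin N, v i = w i} = ∏ i : Fin N, μ i {w i} := by
  have hind : iIndepFun (fun (i : Fin N) (v : ℕ → E) => v i) (Measure.infinitePi μ) :=
    (iIndepFun_infinitePi (X := fun _ => id) fun _ => measurable_id).precomp Fin.val_injective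
  have hinter : {v : ℕ → E | ∀ i : Fin N, v i = w i} =
      ⋂ i : Fin N, (fun v : ℕ → E => v i) ⁻¹' {w i} := by
    ext; simp
  rw [hinter, hind.meas_iInter fun i => ⟨{w i}, measurableSet_singleton _, rfl⟩]
  exact Finset.prod_congr rfl fun i _ => (measurePreserving_eval_infinitePi μ i).measure_preimage
    (measurableSet_singleton _).nullMeasurableSet

/-- The sequence of the `v_k`, `k < K`, continued by zeros: the marks of the atoms present. -/
def truncate {S β : Type*} [Zero β] (K : S → ℕ∞) (v : ℕ → S → β) (s : S) (k : ℕ) : β :=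
  if (k : ℕ∞) < K s then v k s else 0

/-- The random element `(K, (r_k), (ω_k))` that generates `atomSigma`. -/
def atoms {S Ω : Type*} (K : S → ℕ∞) (r : ℕ → S → ℝ≥0) (ω : ℕ → S → Ω) (s : S) :
    ℕ∞ × (ℕ → ℝ≥0) × (ℕ → Ω) :=
  (K s, fun k => r k s, fun k => ω k s)

section Atomic

variable {S Ω : Type*} [MeasurableSpace Ω] {K : S → ℕ∞}

lemma atomicMeasure_apply (K : S → ℕ∞) (w : ℕ → S → ℝ≥0) (ω : ℕ → S → Ω) (s : S) {A : Set Ω}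
    (hA : MeasurableSet A) :
    atomicMeasure K w ω s A = ∑' k : {k | ω k s ∈ A}, ((truncate K w s k : ℝ≥0) : ℝ≥0∞) := by
  rw [atomicMeasure, Measure.sum_apply _ hA,
    tsum_subtype _ fun k => ((truncate K w s k : ℝ≥0) : ℝ≥0∞)]
  refine tsum_congr fun k => ?_
  rw [Measure.smul_apply, Measure.dirac_apply' _ hA]
  by_cases hk : ω k s ∈ A <;> by_cases hK : (k : ℕ∞) < K s <;> simp [truncate, hk, hK]

lemma atomicMeasure_natCast_apply (K : S → ℕ∞) (n : ℕ → S → ℕ) (ω : ℕ → S → Ω) (s : S)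
    {A : Set Ω} (hA : MeasurableSet A) :
    atomicMeasure K (fun k s => (n k s : ℝ≥0)) ω s A =
      ∑' k : {k | ω k s ∈ A}, ((truncate K n s k : ℕ) : ℝ≥0∞) := by
  rw [atomicMeasure_apply _ _ _ _ hA]
  refine tsum_congr fun k => ?_
  by_cases hK : (k : ℕ∞) < K s <;> simp [truncate, hK]

variable [MeasurableSpace S]

lemma measurable_truncate {β : Type*} [Zero β] [MeasurableSpace β] {v : ℕ → S → β}
    (hK : Measurable K) (hv : ∀ k, Measurable (v k)) : Measurable (truncate K v) :=
  measurable_pi_lambda _ fun k =>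
    Measurable.ite (hK (MeasurableSet.of_discrete (s := Ioi (k : ℕ∞)))) (hv k) measurable_const

lemma measurable_tsum_subtype_mem {v : S → ℕ → ℝ≥0∞} (hv : ∀ k, Measurable fun s => v s k)
    {ω : ℕ → S → Ω} (hω : ∀ k, Measurable (ω k)) {A : Set Ω} (hA : MeasurableSet A) :
    Measurable fun s => ∑' k : {k | ω k s ∈ A}, v s k := by
  simp only [tsum_subtype]
  exact Measurable.tsum fun k => (hv k).indicator (hω k hA)

lemma measurable_atomicMeasure {w : ℕ → S → ℝ≥0} {ω : ℕ → S → Ω} (hK : Measurable K)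
    (hw : ∀ k, Measurable (w k)) (hω : ∀ k, Measurable (ω k)) :
    Measurable (atomicMeasure K w ω) := by
  refine Measure.measurable_of_measurable_coe _ fun A hA => ?_
  simp only [atomicMeasure_apply K w ω _ hA]
  have htruncate := measurable_pi_iff.1 (measurable_truncate hK hw)
  exact measurable_tsum_subtype_mem (fun k => (htruncate k).coe_nnreal_ennreal) hω hA

end Atomic

variable {S Ω : Type*} [MeasurableSpace Ω] {ρ : Measure ℝ} {G₀ : Measure Ω}
  {K : S → ℕ∞} {r : ℕ → S → ℝ≥0} {ω : ℕ → S → Ω} {n : ℕ → S → ℕ}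

lemma comap_atomicMeasure_le_atomSigma :
    MeasurableSpace.comap (atomicMeasure K r ω) inferInstance ≤ atomSigma K r ω := by
  let : MeasurableSpace S := atomSigma K r ω
  have hatoms : Measurable (atoms K r ω) := comap_measurable _
  exact (measurable_atomicMeasure hatoms.fst (measurable_pi_iff.1 hatoms.snd.fst)
    (measurable_pi_iff.1 hatoms.snd.snd)).comap_le

variable [MeasurableSpace S] {P : Measure S}

namespace IsCountMixture

lemma measurable_atoms (h : IsCountMixture P ρ G₀ K r ω n) : Measurable (atoms K r ω) :=
  h.measurable_K.prodMk ((measurable_pi_lambda _ h.measurable_r).prodMk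
    (measurable_pi_lambda _ h.measurable_ω))

variable [IsFiniteMeasure P]

lemma condDistrib_truncate_ae_eq (h : IsCountMixture P ρ G₀ K r ω n) :
    ∀ᵐ s ∂P, condDistrib (truncate K n) (atoms K r ω) P (atoms K r ω s) =
      Measure.infinitePi fun k => poissonMeasure (truncate K r s k) := by
  refine condDistrib_ae_eq_of_forall_initial h.measurable_atoms
    (measurable_truncate h.measurable_K h.measurable_n) fun N w => ?_
  simp only [measureReal_def, infinitePi_forall_initial_eq, ENNReal.toReal_prod]
  exact h.cond_counts N w

lemma condExp_atomicMeasure_eq (h : IsCountMixture P ρ G₀ K r ω n) {κ : Type*} [Fintype κ]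
    {A : κ → Set Ω} (hA : ∀ i, MeasurableSet (A i))
    (hdisj : Pairwise fun i j => Disjoint (A i) (A j)) (j : κ → ℕ) :
    P⟦{s | ∀ i, atomicMeasure K (fun k s => (n k s : ℝ≥0)) ω s (A i) = j i} | atomSigma K r ω⟧
      =ᵐ[P] fun s => ∏ i, (poissonMeasure (atomicMeasure K r ω s (A i)).toNNReal).real {j i} := by
  have hF : MeasurableSet {p : (ℕ∞ × (ℕ → ℝ≥0) × (ℕ → Ω)) × (ℕ → ℕ) |
      ∀ i, ∑' k : {k | p.1.2.2 k ∈ A i}, (p.2 k : ℝ≥0∞) = j i} := by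
    rw [ofPred_forall]
    refine MeasurableSet.iInter fun i => ?_
    have hsum := measurable_tsum_subtype_mem (S := (ℕ∞ × (ℕ → ℝ≥0) × (ℕ → Ω)) × (ℕ → ℕ))
      (v := fun p k => (p.2 k : ℝ≥0∞)) (ω := fun k p => p.1.2.2 k)
      (by fun_prop) (by fun_prop) (hA i)
    exact hsum (measurableSet_singleton _)
  have hcond := condExp_prodMk_mem_ae_eq_condDistrib (P := P) h.measurable_atoms
    (measurable_truncate h.measurable_K h.measurable_n) hF
  simp only [atomicMeasure_natCast_apply _ _ _ _ (hA _)]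
  filter_upwards [hcond, h.condDistrib_truncate_ae_eq, h.crm.ae_finite] with s hs hlaw hfinite
  refine hs.trans ?_
  simp only [hlaw, measureReal_def, ← ENNReal.toReal_prod, atomicMeasure_apply _ _ _ _ (hA _)]
  congr 1
  refine infinitePi_poissonMeasure_forall_tsum_eq (D := fun i => {k | ω k s ∈ A i})
    (fun i i' hi => (hdisj hi).preimage _) (fun i => ?_) j
  rw [← atomicMeasure_apply _ _ _ _ (hA i)]
  exact ((measure_mono (subset_univ _)).trans_lt hfinite).ne

theorem isMixedPoissonProcess (h : IsCountMixture P ρ G₀ K r ω n) :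
    IsMixedPoissonProcess P (atomicMeasure K r ω)
      (atomicMeasure K (fun k s => (n k s : ℝ≥0)) ω) where
  measurable_directing := h.crm.measurable
  measurable := measurable_atomicMeasure h.measurable_K
    (fun k => Measurable.of_discrete.comp (h.measurable_n k)) h.measurable_ω
  ae_finite_directing := h.crm.ae_finite
  cond_poisson N A hA hdisj j := by
    have hprod : Measurable fun μ : Measure Ω =>
        ∏ i, (poissonMeasure (μ (A i)).toNNReal).real {j i} :=
      Finset.measurable_prod _ fun i _ =>
        ((continuous_poissonMeasure_singleton (j i)).measurable.comp
          (Measure.measurable_coe (hA i)).ennreal_toNNReal).ennreal_toReal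
    exact condExp_ae_eq_of_le comap_atomicMeasure_le_atomSigma h.measurable_atoms.comap_le
      (hprod.comp (comap_measurable _)) (h.condExp_atomicMeasure_eq hA hdisj j)

end IsCountMixture
end Model

section MixedPoisson

lemma measurable_poissonMeasure : Measurable poissonMeasure :=
  Measure.measurable_of_measurable_coe _ fun B hB => by
    simp only [← Measure.tsum_indicator_apply_singleton _ B hB]
    refine Measurable.tsum fun j => ?_
    by_cases hj : j ∈ B
    · simpa only [indicator_of_mem hj] using (continuous_poissonMeasure_singleton j).measurable
    · simpa only [indicator_of_notMem hj] using measurable_const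

/-- The Poisson distribution as a Markov kernel from the rate to the number of points. -/
noncomputable def poissonMeasureKernel : Kernel ℝ≥0 ℕ := ⟨poissonMeasure, measurable_poissonMeasure⟩

instance : IsMarkovKernel poissonMeasureKernel :=
  ⟨fun c => inferInstanceAs (IsProbabilityMeasure (poissonMeasure c))⟩

lemma integral_exp_poissonMeasure (c : ℝ≥0) (u : ℝ) :
    ∫ j, Complex.exp (Complex.I * u * (j : ℕ)) ∂(poissonMeasure c) =
      Complex.exp (-((1 - Complex.exp (Complex.I * u)) * (c : ℝ))) := by
  have h := charFun_map_cast_poissonMeasure c u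
  rw [charFun_apply_real, integral_map (by fun_prop) (by fun_prop)] at h
  convert h using 2
  · ext j
    congr 1
    push_cast
    ring
  · rw [mul_comm Complex.I]
    ring

/-- The law of a natural number which is Poisson distributed with a random rate of law `μ`. -/
noncomputable def mixedPoisson (μ : Measure ℝ≥0) : Measure ℕ := poissonMeasureKernel ∘ₘ μ

instance (μ : Measure ℝ≥0) [IsProbabilityMeasure μ] : IsProbabilityMeasure (mixedPoisson μ) :=
  inferInstanceAs (IsProbabilityMeasure (poissonMeasureKernel ∘ₘ μ))

lemma mixedPoisson_singleton (μ : Measure ℝ≥0) (j : ℕ) :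
    mixedPoisson μ {j} = ∫⁻ c, poissonMeasure c {j} ∂μ :=
  Measure.bind_apply (measurableSet_singleton j) poissonMeasureKernel.aemeasurable

lemma integral_exp_mixedPoisson (μ : Measure ℝ≥0) [IsFiniteMeasure μ] (u : ℝ) :
    ∫ j, Complex.exp (Complex.I * u * (j : ℕ)) ∂(mixedPoisson μ) =
      ∫ c, Complex.exp (-((1 - Complex.exp (Complex.I * u)) * ((c : ℝ≥0) : ℝ))) ∂μ := by
  have hcomp : mixedPoisson μ = (poissonMeasureKernel ∘ₖ Kernel.const Unit μ) () := by
    rw [Kernel.comp_apply, Kernel.const_apply, mixedPoisson]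
  rw [hcomp, Kernel.integral_comp, Kernel.const_apply]
  · exact integral_congr_ae (.of_forall fun c => integral_exp_poissonMeasure c u)
  · refine Integrable.of_bound (by fun_prop) 1 (.of_forall fun j => ?_)
    rw [mul_assoc, ← Complex.ofReal_natCast, ← Complex.ofReal_mul, Complex.norm_exp_I_mul_ofReal]

namespace IsMixedPoissonProcess

variable {S Ω : Type*} [MeasurableSpace S] [MeasurableSpace Ω] {P : Measure S}
  [IsProbabilityMeasure P] {G X : S → Measure Ω} {N : ℕ} {A : Fin N → Set Ω} {B : Set Ω}

lemma measure_forall_eq (h : IsMixedPoissonProcess P G X) (hA : ∀ i, MeasurableSet (A i))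
    (hdisj : Pairwise fun i j => Disjoint (A i) (A j)) (j : Fin N → ℕ) :
    P {s | ∀ i, X s (A i) = j i} = ∫⁻ s, ∏ i, poissonMeasure (G s (A i)).toNNReal {j i} ∂P := by
  have hmeas : MeasurableSet {s | ∀ i, X s (A i) = j i} := by
    rw [ofPred_forall]
    exact MeasurableSet.iInter fun i =>
      ((Measure.measurable_coe (hA i)).comp h.measurable) (measurableSet_singleton _)
  have hprod : Measurable fun s => ∏ i, poissonMeasure (G s (A i)).toNNReal {j i} :=
    Finset.measurable_prod _ fun i _ => (continuous_poissonMeasure_singleton (j i)).measurable.comp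
      ((Measure.measurable_coe (hA i)).comp h.measurable_directing).ennreal_toNNReal
  have hlt (s : S) : ∏ i, poissonMeasure (G s (A i)).toNNReal {j i} < ∞ :=
    ENNReal.prod_lt_top fun i _ => measure_lt_top _ _
  rw [← ENNReal.toReal_eq_toReal_iff' (measure_ne_top _ _), ← measureReal_def,
    ← integral_indicator_one hmeas, ← integral_condExp h.measurable_directing.comap_le,
    ← integral_toReal hprod.aemeasurable (.of_forall hlt)]
  · simp only [ENNReal.toReal_prod]
    exact integral_congr_ae (h.cond_poisson N A hA hdisj j)
  · refine ((lintegral_mono fun s => Finset.prod_le_one' fun i _ => prob_le_one).trans_lt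
      (?_ : ∫⁻ _, 1 ∂P < ∞)).ne
    simp

lemma map_apply (h : IsMixedPoissonProcess P G X) (hB : MeasurableSet B) :
    P.map (fun s => X s B) =
      (mixedPoisson (P.map fun s => (G s B).toNNReal)).map (Nat.cast : ℕ → ℝ≥0∞) := by
  have hX : Measurable fun s => X s B := (Measure.measurable_coe hB).comp h.measurable
  have hG : Measurable fun s => (G s B).toNNReal :=
    ((Measure.measurable_coe hB).comp h.measurable_directing).ennreal_toNNReal
  have := Measure.isProbabilityMeasure_map (μ := P) hX.aemeasurable
  have := Measure.isProbabilityMeasure_map (μ := P) hG.aemeasurable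
  refine eq_map_of_forall_singleton (by fun_prop) Nat.cast_injective fun j => ?_
  rw [Measure.map_apply hX (measurableSet_singleton _), mixedPoisson_singleton,
    lintegral_map (continuous_poissonMeasure_singleton j).measurable hG]
  simpa [Subsingleton.pairwise, preimage] using
    h.measure_forall_eq (N := 1) (A := fun _ => B) (fun _ => hB) Subsingleton.pairwise fun _ => j

lemma iIndepFun_apply (h : IsMixedPoissonProcess P G X) (hA : ∀ i, MeasurableSet (A i))
    (hdisj : Pairwise fun i j => Disjoint (A i) (A j)) (hG : iIndepFun (fun i s => G s (A i)) P) :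
    iIndepFun (fun i s => X s (A i)) P := by
  have hXm (i : Fin N) : Measurable fun s => X s (A i) :=
    (Measure.measurable_coe (hA i)).comp h.measurable
  have hGm (i : Fin N) : Measurable fun s => G s (A i) :=
    (Measure.measurable_coe (hA i)).comp h.measurable_directing
  have hX := Measure.isProbabilityMeasure_map (μ := P) (measurable_pi_lambda _ hXm).aemeasurable
  have (i : Fin N) :=
    Measure.isProbabilityMeasure_map (μ := P) (hGm i).ennreal_toNNReal.aemeasurable
  rw [iIndepFun_iff_map_fun_eq_pi_map fun i => (hXm i).aemeasurable]
  simp only [h.map_apply (hA _)]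
  rw [← Measure.pi_map_pi fun i => by fun_prop]
  refine eq_map_of_forall_singleton (by fun_prop)
    (fun j j' hj => funext fun i => Nat.cast_injective (congrFun hj i)) fun j => ?_
  have hφ (i : Fin N) : Measurable fun x : ℝ≥0∞ => poissonMeasure x.toNNReal {j i} :=
    (continuous_poissonMeasure_singleton (j i)).measurable.comp measurable_id.ennreal_toNNReal
  calc P.map (fun s i => X s (A i)) {fun i => (j i : ℝ≥0∞)}
      = P {s | ∀ i, X s (A i) = j i} := by
        rw [Measure.map_apply (measurable_pi_lambda _ hXm) (measurableSet_singleton _)]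
        simp [preimage, funext_iff]
    _ = ∫⁻ s, ∏ i, poissonMeasure (G s (A i)).toNNReal {j i} ∂P := h.measure_forall_eq hA hdisj j
    _ = ∏ i, ∫⁻ s, poissonMeasure (G s (A i)).toNNReal {j i} ∂P :=
        lintegral_prod_eq_prod_lintegral_of_indepFun Finset.univ _ (hG.comp _ hφ)
          fun i => (hφ i).comp (hGm i)
    _ = Measure.pi (fun i => mixedPoisson (P.map fun s => (G s (A i)).toNNReal)) {j} := by
        rw [Measure.pi_singleton]
        refine Finset.prod_congr rfl fun i _ => ?_
        rw [mixedPoisson_singleton, lintegral_map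
          (continuous_poissonMeasure_singleton (j i)).measurable (hGm i).ennreal_toNNReal]

lemma ae_lt_top (h : IsMixedPoissonProcess P G X) : ∀ᵐ s ∂P, X s univ < ∞ := by
  have hX : Measurable fun s => X s univ := (Measure.measurable_coe .univ).comp h.measurable
  refine ae_of_ae_map hX.aemeasurable (p := (· < ∞)) ?_
  rw [h.map_apply .univ, ae_map_iff (by fun_prop) measurableSet_Iio]
  exact .of_forall ENNReal.natCast_lt_top

lemma integral_exp_eq (h : IsMixedPoissonProcess P G X) (hB : MeasurableSet B) (u : ℝ) :
    ∫ s, Complex.exp (Complex.I * u * (X s B).toReal) ∂P =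
      ∫ s, Complex.exp (-((1 - Complex.exp (Complex.I * u)) * (G s B).toReal)) ∂P := by
  have hX : Measurable fun s => X s B := (Measure.measurable_coe hB).comp h.measurable
  have hG : Measurable fun s => (G s B).toNNReal :=
    ((Measure.measurable_coe hB).comp h.measurable_directing).ennreal_toNNReal
  have := Measure.isProbabilityMeasure_map (μ := P) hG.aemeasurable
  calc ∫ s, Complex.exp (Complex.I * u * (X s B).toReal) ∂P
      = ∫ x : ℝ≥0∞, Complex.exp (Complex.I * u * x.toReal) ∂P.map fun s => X s B :=
        (integral_map (f := fun x : ℝ≥0∞ => Complex.exp (Complex.I * u * x.toReal))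
          hX.aemeasurable (Measurable.aestronglyMeasurable (by fun_prop))).symm
    _ = ∫ j, Complex.exp (Complex.I * u * (j : ℕ))
          ∂mixedPoisson (P.map fun s => (G s B).toNNReal) := by
        rw [h.map_apply hB,
          integral_map (by fun_prop) (Measurable.aestronglyMeasurable (by fun_prop))]
        simp only [ENNReal.toReal_natCast, Complex.ofReal_natCast]
    _ = ∫ s, Complex.exp (-((1 - Complex.exp (Complex.I * u)) * (G s B).toReal)) ∂P := by
        rw [integral_exp_mixedPoisson,
          integral_map hG.aemeasurable (Measurable.aestronglyMeasurable (by fun_prop))]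
        rfl

end IsMixedPoissonProcess

end MixedPoisson

section Laplace

lemma norm_exp_neg_le_one {w : ℂ} (hw : 0 ≤ w.re) : ‖Complex.exp (-w)‖ ≤ 1 := by
  rw [Complex.norm_exp]
  simpa using hw

lemma norm_exp_neg_sub_one_le {w : ℂ} (hw : 0 ≤ w.re) : ‖Complex.exp (-w) - 1‖ ≤ ‖w‖ := by
  have h := (convex_halfSpace_re_ge 0).norm_image_sub_le_of_norm_hasDerivWithin_le
    (f := fun w => Complex.exp (-w)) (f' := fun w => Complex.exp (-w) * -1) (C := 1)
    (fun x _ => ((hasDerivAt_id x).neg.cexp).hasDerivWithinAt)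
    (fun x hx => by simpa using norm_exp_neg_le_one hx) (x := 0) (y := w) (by simp) hw
  simpa using h

lemma re_mul_ofReal_nonneg {z : ℂ} (hz : 0 ≤ z.re) {x : ℝ} (hx : 0 ≤ x) : 0 ≤ (z * x).re := by
  simpa using mul_nonneg hz hx

lemma norm_exp_neg_mul_sub_one_le {z : ℂ} (hz : 0 ≤ z.re) {x : ℝ} (hx : 0 ≤ x) :
    ‖Complex.exp (-(z * x)) - 1‖ ≤ (2 + ‖z‖) * min 1 x := by
  have hw := re_mul_ofReal_nonneg hz hx
  rcases le_total 1 x with h | h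
  · rw [min_eq_left h]
    calc ‖Complex.exp (-(z * x)) - 1‖ ≤ ‖Complex.exp (-(z * x))‖ + ‖(1 : ℂ)‖ := norm_sub_le _ _
      _ ≤ 1 + 1 := by gcongr; exacts [norm_exp_neg_le_one hw, norm_one.le]
      _ ≤ (2 + ‖z‖) * 1 := by linarith [norm_nonneg z]
  · rw [min_eq_right h]
    calc ‖Complex.exp (-(z * x)) - 1‖ ≤ ‖z * x‖ := norm_exp_neg_sub_one_le hw
      _ = ‖z‖ * x := by rw [norm_mul, Complex.norm_real, Real.norm_of_nonneg hx]
      _ ≤ (2 + ‖z‖) * x := by gcongr; linarith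

lemma mul_exp_neg_mul_le {a x : ℝ} (ha : 0 < a) (hx : 0 ≤ x) :
    x * Real.exp (-(a * x)) ≤ (1 + 1 / a) * min 1 x := by
  have ha' : 0 ≤ 1 / a := by positivity
  rcases le_total 1 x with h | h
  · have hmul : x * Real.exp (-(a * x)) ≤ 1 / a := by
      rw [Real.exp_neg, ← div_eq_mul_inv, div_le_div_iff₀ (Real.exp_pos _) ha]
      linarith [Real.add_one_le_exp (a * x)]
    rw [min_eq_left h]
    linarith
  · have hexp : Real.exp (-(a * x)) ≤ 1 := Real.exp_le_one_iff.2 (by nlinarith)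
    rw [min_eq_right h]
    nlinarith

variable {α : Type*} [MeasurableSpace α]

/-- The Laplace exponent `z ↦ ∫ (exp(-zY) - 1) dμ` of a driftless infinitely divisible variable
with jump sizes `Y` under `μ`. It is meant for `0 ≤ re z` and `μ`-integrable `min{1, Y}`. -/
noncomputable def laplaceExponent (μ : Measure α) (Y : α → ℝ) (z : ℂ) : ℂ :=
  ∫ a, (Complex.exp (-(z * Y a)) - 1) ∂μ

section LaplaceExponent

variable {μ : Measure α} {Y : α → ℝ}

lemma integrable_exp_neg_mul_sub_one (hY : AEMeasurable Y μ) (h0 : ∀ᵐ a ∂μ, 0 ≤ Y a)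
    (hint : Integrable (fun a => min 1 (Y a)) μ) {z : ℂ} (hz : 0 ≤ z.re) :
    Integrable (fun a => Complex.exp (-(z * Y a)) - 1) μ := by
  refine (hint.const_mul (2 + ‖z‖)).mono' (AEMeasurable.aestronglyMeasurable (by fun_prop)) ?_
  filter_upwards [h0] with a ha using norm_exp_neg_mul_sub_one_le hz ha

lemma differentiableAt_laplaceExponent (hY : AEMeasurable Y μ) (h0 : ∀ᵐ a ∂μ, 0 ≤ Y a)
    (hint : Integrable (fun a => min 1 (Y a)) μ) {z₀ : ℂ} (hz₀ : 0 < z₀.re) :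
    DifferentiableAt ℂ (laplaceExponent μ Y) z₀ := by
  have hball : ∀ z ∈ Metric.ball z₀ (z₀.re / 2), z₀.re / 2 ≤ z.re := by
    intro z hz
    have hre := (abs_le.1 ((Complex.abs_re_le_norm (z - z₀)).trans (mem_ball_iff_norm.1 hz).le)).1
    rw [Complex.sub_re] at hre
    linarith
  have hderiv (z : ℂ) (a : α) : HasDerivAt (fun z => Complex.exp (-(z * Y a)) - 1)
      (Complex.exp (-(z * Y a)) * -(Y a)) z := by
    simpa using (((hasDerivAt_id z).mul_const (Y a : ℂ)).neg.cexp).sub_const 1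
  refine (hasDerivAt_integral_of_dominated_loc_of_deriv_le
    (Metric.ball_mem_nhds z₀ (half_pos hz₀))
    (.of_forall fun z => AEMeasurable.aestronglyMeasurable (by fun_prop))
    (integrable_exp_neg_mul_sub_one hY h0 hint hz₀.le)
    (AEMeasurable.aestronglyMeasurable (by fun_prop)) ?_
    (hint.const_mul (1 + 1 / (z₀.re / 2)))
    (.of_forall fun a z _ => hderiv z a)).2.differentiableAt
  filter_upwards [h0] with a ha z hz
  calc ‖Complex.exp (-(z * Y a)) * -(Y a : ℂ)‖ = Y a * Real.exp (-(z.re * Y a)) := by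
        rw [norm_mul, Complex.norm_exp, norm_neg, Complex.norm_real, Real.norm_of_nonneg ha,
          mul_comm, Complex.neg_re, Complex.re_mul_ofReal]
    _ ≤ Y a * Real.exp (-(z₀.re / 2 * Y a)) := by gcongr; exact hball z hz
    _ ≤ (1 + 1 / (z₀.re / 2)) * min 1 (Y a) := mul_exp_neg_mul_le (half_pos hz₀) ha

lemma continuousOn_laplaceExponent (hY : AEMeasurable Y μ) (h0 : ∀ᵐ a ∂μ, 0 ≤ Y a)
    (hint : Integrable (fun a => min 1 (Y a)) μ) :
    ContinuousOn (laplaceExponent μ Y) {z | 0 ≤ z.re} := by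
  intro z₀ _
  refine continuousWithinAt_of_dominated (bound := fun a => (3 + ‖z₀‖) * min 1 (Y a))
    (.of_forall fun z => AEMeasurable.aestronglyMeasurable (by fun_prop)) ?_ (hint.const_mul _)
    (.of_forall fun a => Continuous.continuousWithinAt (by fun_prop))
  have hnorm : ∀ᶠ z in 𝓝[{z : ℂ | 0 ≤ z.re}] z₀, ‖z‖ < 1 + ‖z₀‖ :=
    (continuous_norm.continuousAt.eventually_lt continuousAt_const
      (by linarith)).filter_mono nhdsWithin_le_nhds
  filter_upwards [hnorm, self_mem_nhdsWithin] with z hz hz'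
  filter_upwards [h0] with a ha
  refine (norm_exp_neg_mul_sub_one_le hz' ha).trans ?_
  exact mul_le_mul_of_nonneg_right (by linarith) (le_min zero_le_one ha)

lemma diffContOnCl_laplaceExponent (hY : AEMeasurable Y μ) (h0 : ∀ᵐ a ∂μ, 0 ≤ Y a)
    (hint : Integrable (fun a => min 1 (Y a)) μ) :
    DiffContOnCl ℂ (laplaceExponent μ Y) {z | 0 < z.re} where
  differentiableOn _ hz :=
    (differentiableAt_laplaceExponent hY h0 hint hz).differentiableWithinAt
  continuousOn := by
    rw [Complex.closure_setOfPred_lt_re]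
    exact continuousOn_laplaceExponent hY h0 hint

lemma norm_exp_laplaceExponent_le_one (hY : AEMeasurable Y μ) (h0 : ∀ᵐ a ∂μ, 0 ≤ Y a)
    (hint : Integrable (fun a => min 1 (Y a)) μ) {z : ℂ} (hz : 0 ≤ z.re) :
    ‖Complex.exp (laplaceExponent μ Y z)‖ ≤ 1 := by
  have hre := integral_re (integrable_exp_neg_mul_sub_one hY h0 hint hz)
  simp only [RCLike.re_eq_complex_re] at hre
  rw [Complex.norm_exp, Real.exp_le_one_iff, laplaceExponent, ← hre]
  refine integral_nonpos_of_ae ?_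
  filter_upwards [h0] with a ha
  have hle := (Complex.re_le_norm _).trans (norm_exp_neg_le_one (re_mul_ofReal_nonneg hz ha))
  simpa using hle

end LaplaceExponent

lemma eq_of_diffContOnCl_of_bounded_of_eq_on_imaginary_axis {E : Type*} [NormedAddCommGroup E]
    [NormedSpace ℂ E] {f g : ℂ → E} {C : ℝ} (hf : DiffContOnCl ℂ f {z | 0 < z.re})
    (hg : DiffContOnCl ℂ g {z | 0 < z.re}) (hfC : ∀ z : ℂ, 0 ≤ z.re → ‖f z‖ ≤ C)
    (hgC : ∀ z : ℂ, 0 ≤ z.re → ‖g z‖ ≤ C)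
    (heq : ∀ x : ℝ, f (x * Complex.I) = g (x * Complex.I)) {z : ℂ} (hz : 0 ≤ z.re) :
    f z = g z := by
  have hbound (w : ℂ) (hw : 0 ≤ w.re) : ‖(f - g) w‖ ≤ C + C :=
    (norm_sub_le _ _).trans (add_le_add (hfC w hw) (hgC w hw))
  have hzero : ‖(f - g) z‖ ≤ 0 := by
    refine PhragmenLindelof.right_half_plane_of_bounded_on_real (hf.sub hg)
      ⟨0, two_pos, 0, ?_⟩ ?_ (fun x => ?_) hz
    · refine Asymptotics.IsBigO.of_bound (C + C) ?_
      filter_upwards [mem_inf_of_right (mem_principal_self _)] with w hw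
      simpa using hbound w (le_of_lt hw)
    · refine isBoundedUnder_of_eventually_le (a := C + C) ?_
      filter_upwards [eventually_ge_atTop 0] with x hx using hbound x (by simpa using hx)
    · simp [heq x]
  exact sub_eq_zero.1 (norm_le_zero_iff.1 hzero)

section RandomVariable

variable {S : Type*} [MeasurableSpace S] {P : Measure S} [IsProbabilityMeasure P] {Z : S → ℝ}

lemma integral_exp_neg_mul_eq_one_add_laplaceExponent (hZ : Measurable Z) (hZ0 : ∀ s, 0 ≤ Z s)
    {z : ℂ} (hz : 0 ≤ z.re) :
    ∫ s, Complex.exp (-(z * Z s)) ∂P = 1 + laplaceExponent P Z z := by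
  have hint : Integrable (fun s => Complex.exp (-(z * Z s))) P :=
    Integrable.of_bound (by fun_prop) 1
      (.of_forall fun s => norm_exp_neg_le_one (re_mul_ofReal_nonneg hz (hZ0 s)))
  rw [laplaceExponent, integral_sub hint (integrable_const 1)]
  simp

lemma diffContOnCl_integral_exp_neg_mul (hZ : Measurable Z) (hZ0 : ∀ s, 0 ≤ Z s) :
    DiffContOnCl ℂ (fun z => ∫ s, Complex.exp (-(z * Z s)) ∂P) {z | 0 < z.re} := by
  have hint : Integrable (fun s => min 1 (Z s)) P := by
    refine Integrable.of_bound (by fun_prop) 1 (.of_forall fun s => ?_)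
    rw [Real.norm_of_nonneg (le_min zero_le_one (hZ0 s))]
    exact min_le_left _ _
  have h := (diffContOnCl_laplaceExponent hZ.aemeasurable (.of_forall hZ0) hint).const_add 1
  refine ⟨h.differentiableOn.congr fun z hz => ?_, h.continuousOn.congr fun z hz => ?_⟩
  · exact integral_exp_neg_mul_eq_one_add_laplaceExponent hZ hZ0 (le_of_lt hz)
  · rw [Complex.closure_setOfPred_lt_re] at hz
    exact integral_exp_neg_mul_eq_one_add_laplaceExponent hZ hZ0 hz

lemma norm_integral_exp_neg_mul_le_one (hZ0 : ∀ s, 0 ≤ Z s) {z : ℂ} (hz : 0 ≤ z.re) :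
    ‖∫ s, Complex.exp (-(z * Z s)) ∂P‖ ≤ 1 := by
  simpa using norm_integral_le_of_norm_le_const (μ := P)
    (.of_forall fun s => norm_exp_neg_le_one (re_mul_ofReal_nonneg hz (hZ0 s)))

theorem integral_exp_neg_mul_eq_exp_laplaceExponent {μ : Measure α} {Y : α → ℝ}
    (hZ : Measurable Z) (hZ0 : ∀ s, 0 ≤ Z s) (hY : AEMeasurable Y μ) (h0 : ∀ᵐ a ∂μ, 0 ≤ Y a)
    (hint : Integrable (fun a => min 1 (Y a)) μ)
    (hchar : ∀ u : ℝ, ∫ s, Complex.exp (Complex.I * u * Z s) ∂P =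
      Complex.exp (∫ a, (Complex.exp (Complex.I * u * Y a) - 1) ∂μ)) {z : ℂ} (hz : 0 ≤ z.re) :
    ∫ s, Complex.exp (-(z * Z s)) ∂P = Complex.exp (laplaceExponent μ Y z) := by
  refine eq_of_diffContOnCl_of_bounded_of_eq_on_imaginary_axis (C := 1)
    (f := fun z => ∫ s, Complex.exp (-(z * Z s)) ∂P)
    (diffContOnCl_integral_exp_neg_mul hZ hZ0)
    (Complex.differentiable_exp.comp_diffContOnCl (diffContOnCl_laplaceExponent hY h0 hint))
    (fun z hz => norm_integral_exp_neg_mul_le_one hZ0 hz)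
    (fun z hz => norm_exp_laplaceExponent_le_one hY h0 hint hz) (fun x => ?_) hz
  have hx (y : ℝ) : -(x * Complex.I * y) = Complex.I * ((-x : ℝ) : ℂ) * y := by
    push_cast
    ring
  simpa only [laplaceExponent, Function.comp_apply, hx] using hchar (-x)

end RandomVariable

section CompletelyRandomMeasure

variable {S Ω : Type*} [MeasurableSpace S] [MeasurableSpace Ω] {ν : Measure (ℝ × Ω)}

lemma IsLevyMeasure.ae_pos_fst (hν : IsLevyMeasure ν) : ∀ᵐ p ∂ν, 0 < p.1 := by
  rw [ae_iff]
  refine measure_mono_null (fun p hp => ?_) hν.null_nonpos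
  exact ⟨not_lt.1 hp, mem_univ _⟩

lemma IsLevyMeasure.integrable_min_one_fst (hν : IsLevyMeasure ν) :
    Integrable (fun p => min 1 p.1) ν := by
  refine ⟨by fun_prop, ?_⟩
  rw [hasFiniteIntegral_iff_ofReal]
  · exact hν.lintegral_min_lt_top
  · filter_upwards [hν.ae_pos_fst] with p hp using le_min zero_le_one hp.le

theorem IsCompletelyRandomMeasure.integral_exp_neg_mul {P : Measure S} [IsProbabilityMeasure P]
    {G : S → Measure Ω} (h : IsCompletelyRandomMeasure P G ν) {A : Set Ω} (hA : MeasurableSet A)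
    {z : ℂ} (hz : 0 ≤ z.re) :
    ∫ s, Complex.exp (-(z * (G s A).toReal)) ∂P =
      Complex.exp (∫ p in univ ×ˢ A, (Complex.exp (-(z * p.1)) - 1) ∂ν) :=
  integral_exp_neg_mul_eq_exp_laplaceExponent
    ((Measure.measurable_coe hA).comp h.measurable).ennreal_toReal
    (fun _ => ENNReal.toReal_nonneg) measurable_fst.aemeasurable
    (ae_restrict_of_ae (h.isLevyMeasure.ae_pos_fst.mono fun _ hp => hp.le))
    h.isLevyMeasure.integrable_min_one_fst.restrict (h.charFun_eq A hA) hz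

end CompletelyRandomMeasure

end Laplace

section PoissonWeights

/-- The probability which the Poisson distribution with mean `x ≥ 0` gives to `j`. The mean is a
real number, as the jump sizes in a Lévy measure are. -/
noncomputable def poissonWeight (j : ℕ) (x : ℝ) : ℝ := x ^ j * Real.exp (-x) / j.factorial

lemma continuous_poissonWeight (j : ℕ) : Continuous (poissonWeight j) := by
  unfold poissonWeight
  fun_prop

lemma poissonWeight_nonneg (j : ℕ) {x : ℝ} (hx : 0 ≤ x) : 0 ≤ poissonWeight j x := by
  unfold poissonWeight
  positivity

lemma hasSum_pow_mul_poissonWeight (w : ℂ) (x : ℝ) :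
    HasSum (fun j => w ^ j * (poissonWeight j x : ℂ)) (Complex.exp (-((1 - w) * x))) := by
  have h := (NormedSpace.expSeries_div_hasSum_exp (w * (x : ℂ))).mul_right (Complex.exp (-x))
  rw [← Complex.exp_eq_exp_ℂ, ← Complex.exp_add, show w * x + -(x : ℂ) = -((1 - w) * x) by ring]
    at h
  refine h.congr_fun fun j => ?_
  rw [poissonWeight]
  push_cast
  ring

lemma hasSum_pow_sub_one_mul_poissonWeight_succ (w : ℂ) (x : ℝ) :
    HasSum (fun m : ℕ => (w ^ (m + 1) - 1) * (poissonWeight (m + 1) x : ℂ))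
      (Complex.exp (-((1 - w) * x)) - 1) := by
  have h := (hasSum_nat_add_iff' 1).2
    ((hasSum_pow_mul_poissonWeight w x).sub (hasSum_pow_mul_poissonWeight 1 x))
  simpa [sub_mul] using h

lemma hasSum_poissonWeight_succ (x : ℝ) :
    HasSum (fun m : ℕ => poissonWeight (m + 1) x) (1 - Real.exp (-x)) := by
  have h := (hasSum_pow_sub_one_mul_poissonWeight_succ 0 x).neg
  rw [← Complex.hasSum_ofReal]
  simpa using h

lemma setIntegral_univ_prod_fst {α Ω : Type*} [MeasurableSpace α] [MeasurableSpace Ω]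
    (ν : Measure α) [SFinite ν] (G₀ : Measure Ω) [SFinite G₀] (A : Set Ω) (f : α → ℂ) :
    ∫ p in univ ×ˢ A, f p.1 ∂(ν.prod G₀) = (G₀ A).toReal * ∫ x, f x ∂ν := by
  rw [← Measure.prod_restrict, Measure.restrict_univ, integral_fun_fst]
  simp [measureReal_def]

/-- The mass `∫ x ^ j * exp (-x) / j! ρ(dx)` over the positive half line. A Poisson variable whose
mean is a jump of size `x` turns the Lévy measure `ρ` into one with mass `jumpMass ρ j` at `j`. -/
noncomputable def jumpMass (ρ : Measure ℝ) (j : ℕ) : ℝ≥0∞ :=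
  ∫⁻ x in Ioi 0, ENNReal.ofReal (poissonWeight j x) ∂ρ

lemma mixtureLevyMeasure_eq_sum_jumpMass {Ω : Type*} [MeasurableSpace Ω] (ρ : Measure ℝ)
    (G₀ : Measure Ω) : mixtureLevyMeasure ρ G₀ =
      Measure.sum fun m : ℕ => jumpMass ρ (m + 1) • (Measure.dirac ((m + 1 : ℕ) : ℝ)).prod G₀ :=
  rfl

variable {ρ : Measure ℝ}

lemma ae_restrict_poissonWeight_nonneg (j : ℕ) : 0 ≤ᵐ[ρ.restrict (Ioi 0)] poissonWeight j := by
  filter_upwards [ae_restrict_mem measurableSet_Ioi] with x hx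
    using poissonWeight_nonneg j (le_of_lt hx)

lemma integral_poissonWeight_eq_toReal_jumpMass (j : ℕ) :
    ∫ x in Ioi 0, poissonWeight j x ∂ρ = (jumpMass ρ j).toReal :=
  integral_eq_lintegral_of_nonneg_ae (ae_restrict_poissonWeight_nonneg j)
    (continuous_poissonWeight j).aestronglyMeasurable

lemma tsum_jumpMass_succ_lt_top (hint : ∫⁻ x, ENNReal.ofReal (min 1 x) ∂ρ < ∞) :
    ∑' m, jumpMass ρ (m + 1) < ∞ := by
  unfold jumpMass
  rw [← lintegral_tsum fun m =>
    (continuous_poissonWeight _).measurable.ennreal_ofReal.aemeasurable]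
  refine lt_of_le_of_lt (le_trans ?_ (setLIntegral_le_lintegral (Ioi 0) _)) hint
  refine setLIntegral_mono (by fun_prop) fun x hx => ?_
  have hsum := hasSum_poissonWeight_succ x
  rw [← ENNReal.ofReal_tsum_of_nonneg (fun m => poissonWeight_nonneg _ (le_of_lt hx)) hsum.summable,
    hsum.tsum_eq]
  refine ENNReal.ofReal_le_ofReal (le_min ?_ ?_)
  · linarith [Real.exp_pos (-x)]
  · linarith [Real.add_one_le_exp (-x)]

lemma jumpMass_succ_lt_top (hint : ∫⁻ x, ENNReal.ofReal (min 1 x) ∂ρ < ∞) (m : ℕ) :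
    jumpMass ρ (m + 1) < ∞ :=
  (ENNReal.le_tsum m).trans_lt (tsum_jumpMass_succ_lt_top hint)

lemma integrableOn_poissonWeight_succ (hint : ∫⁻ x, ENNReal.ofReal (min 1 x) ∂ρ < ∞)
    (m : ℕ) : IntegrableOn (poissonWeight (m + 1)) (Ioi 0) ρ := by
  refine ⟨(continuous_poissonWeight _).aestronglyMeasurable, ?_⟩
  rw [hasFiniteIntegral_iff_ofReal (ae_restrict_poissonWeight_nonneg _)]
  exact jumpMass_succ_lt_top hint m

lemma summable_integral_poissonWeight_succ (hint : ∫⁻ x, ENNReal.ofReal (min 1 x) ∂ρ < ∞) :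
    Summable fun m : ℕ => ∫ x in Ioi 0, poissonWeight (m + 1) x ∂ρ := by
  simp only [integral_poissonWeight_eq_toReal_jumpMass]
  exact ENNReal.summable_toReal (tsum_jumpMass_succ_lt_top hint).ne

lemma hasSum_pow_sub_one_mul_integral_poissonWeight_succ
    (hint : ∫⁻ x, ENNReal.ofReal (min 1 x) ∂ρ < ∞) {w : ℂ} (hw : ‖w‖ ≤ 1) :
    HasSum (fun m : ℕ =>
        (w ^ (m + 1) - 1) * ((∫ x in Ioi 0, poissonWeight (m + 1) x ∂ρ : ℝ) : ℂ))
      (∫ x in Ioi 0, (Complex.exp (-((1 - w) * (x : ℝ))) - 1) ∂ρ) := by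
  have hpow (m : ℕ) : ‖w ^ (m + 1) - 1‖ ≤ 2 := by
    calc ‖w ^ (m + 1) - 1‖ ≤ ‖w‖ ^ (m + 1) + ‖(1 : ℂ)‖ := by
          rw [← norm_pow]
          exact norm_sub_le _ _
      _ ≤ 1 + 1 := add_le_add (pow_le_one₀ (norm_nonneg w) hw) norm_one.le
      _ = 2 := one_add_one_eq_two
  have hnorm (m : ℕ) :
      ∫ x in Ioi 0, ‖(w ^ (m + 1) - 1) * (poissonWeight (m + 1) x : ℂ)‖ ∂ρ =
        ‖w ^ (m + 1) - 1‖ * ∫ x in Ioi 0, poissonWeight (m + 1) x ∂ρ := by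
    rw [← integral_const_mul]
    refine integral_congr_ae ?_
    filter_upwards [ae_restrict_poissonWeight_nonneg (m + 1)] with x hx
    rw [norm_mul, Complex.norm_real, Real.norm_of_nonneg hx]
  have hsummable : Summable fun m : ℕ =>
      ∫ x in Ioi 0, ‖(w ^ (m + 1) - 1) * (poissonWeight (m + 1) x : ℂ)‖ ∂ρ := by
    simp only [hnorm]
    refine ((summable_integral_poissonWeight_succ hint).mul_left 2).of_nonneg_of_le
      (fun m => ?_) (fun m => ?_)
    · exact mul_nonneg (norm_nonneg _) (integral_nonneg_of_ae (ae_restrict_poissonWeight_nonneg _))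
    · gcongr
      · exact integral_nonneg_of_ae (ae_restrict_poissonWeight_nonneg _)
      · exact hpow m
  have h := hasSum_integral_of_summable_integral_norm (μ := ρ.restrict (Ioi 0))
    (F := fun (m : ℕ) (x : ℝ) => (w ^ (m + 1) - 1) * (poissonWeight (m + 1) x : ℂ))
    (fun m => (integrableOn_poissonWeight_succ hint m).ofReal.const_mul (w ^ (m + 1) - 1)) hsummable
  simp only [(hasSum_pow_sub_one_mul_poissonWeight_succ w _).tsum_eq, integral_const_mul,
    integral_complex_ofReal] at h
  exact h

variable {Ω : Type*} [MeasurableSpace Ω] (G₀ : Measure Ω) [IsFiniteMeasure G₀]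

lemma isFiniteMeasure_mixtureLevyMeasure (hint : ∫⁻ x, ENNReal.ofReal (min 1 x) ∂ρ < ∞) :
    IsFiniteMeasure (mixtureLevyMeasure ρ G₀) := by
  constructor
  rw [mixtureLevyMeasure_eq_sum_jumpMass, Measure.sum_apply _ MeasurableSet.univ]
  simp only [Measure.smul_apply, smul_eq_mul, ← univ_prod_univ, Measure.prod_prod, measure_univ,
    one_mul, ENNReal.tsum_mul_right]
  exact ENNReal.mul_lt_top (tsum_jumpMass_succ_lt_top hint) (measure_lt_top _ _)

lemma isLevyMeasure_mixtureLevyMeasure (hint : ∫⁻ x, ENNReal.ofReal (min 1 x) ∂ρ < ∞) :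
    IsLevyMeasure (mixtureLevyMeasure ρ G₀) where
  null_nonpos := by
    rw [mixtureLevyMeasure_eq_sum_jumpMass, Measure.sum_apply_eq_zero]
    intro m
    have hm : ((m + 1 : ℕ) : ℝ) ∉ Iic (0 : ℝ) :=
      notMem_Iic.2 (Nat.cast_pos.2 m.succ_pos)
    rw [Measure.smul_apply, Measure.prod_prod, Measure.dirac_apply' _ measurableSet_Iic,
      indicator_of_notMem hm, zero_mul, smul_zero]
  lintegral_min_lt_top := by
    have := isFiniteMeasure_mixtureLevyMeasure G₀ hint
    calc ∫⁻ p, ENNReal.ofReal (min 1 p.1) ∂mixtureLevyMeasure ρ G₀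
        ≤ ∫⁻ _, 1 ∂mixtureLevyMeasure ρ G₀ :=
          lintegral_mono fun p => ENNReal.ofReal_le_one.2 (min_le_left _ _)
      _ = mixtureLevyMeasure ρ G₀ univ := lintegral_one
      _ < ∞ := measure_lt_top _ _

lemma setIntegral_mixtureLevyMeasure (hint : ∫⁻ x, ENNReal.ofReal (min 1 x) ∂ρ < ∞) (A : Set Ω)
    {f : ℝ → ℂ} (hf : Measurable f) {C : ℝ} (hC : ∀ x, ‖f x‖ ≤ C) :
    ∫ p in univ ×ˢ A, f p.1 ∂(mixtureLevyMeasure ρ G₀) =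
      (G₀ A).toReal * ∑' m : ℕ,
        f (m + 1 : ℕ) * ((∫ x in Ioi 0, poissonWeight (m + 1) x ∂ρ : ℝ) : ℂ) := by
  have hfin := isFiniteMeasure_mixtureLevyMeasure G₀ hint
  have hf_int : IntegrableOn (fun p : ℝ × Ω => f p.1) (univ ×ˢ A) (mixtureLevyMeasure ρ G₀) :=
    Integrable.of_bound (Measurable.aestronglyMeasurable (by fun_prop)) C
      (.of_forall fun p => hC p.1)
  rw [IntegrableOn, mixtureLevyMeasure_eq_sum_jumpMass, Measure.restrict_sum_of_countable]
    at hf_int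
  rw [mixtureLevyMeasure_eq_sum_jumpMass, Measure.restrict_sum_of_countable,
    integral_sum_measure hf_int, ← tsum_mul_left]
  refine tsum_congr fun m => ?_
  rw [Measure.restrict_smul, integral_smul_measure, setIntegral_univ_prod_fst, integral_dirac,
    integral_poissonWeight_eq_toReal_jumpMass, Complex.real_smul]
  ring

end PoissonWeights

section MixedCompletelyRandomMeasure

variable {S Ω : Type*} [MeasurableSpace S] [MeasurableSpace Ω] {P : Measure S}
  {ρ : Measure ℝ} {G₀ : Measure Ω} {G X : S → Measure Ω}

lemma exp_I_mul_natCast (u : ℝ) (m : ℕ) :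
    Complex.exp (Complex.I * u * m) = Complex.exp (Complex.I * u) ^ m := by
  rw [← Complex.exp_nat_mul, mul_comm]

lemma norm_exp_I_mul_mul_sub_one_le (u x : ℝ) :
    ‖Complex.exp (Complex.I * u * x) - 1‖ ≤ 2 := by
  refine (norm_sub_le _ _).trans_eq ?_
  rw [mul_assoc, ← Complex.ofReal_mul, Complex.norm_exp_I_mul_ofReal, norm_one,
    one_add_one_eq_two]

lemma hasSum_exp_sub_one_mul_integral_poissonWeight_succ
    (hint : ∫⁻ x, ENNReal.ofReal (min 1 x) ∂ρ < ∞) (u : ℝ) :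
    HasSum (fun m : ℕ => (Complex.exp (Complex.I * u * (m + 1 : ℕ)) - 1) *
        ((∫ x in Ioi 0, poissonWeight (m + 1) x ∂ρ : ℝ) : ℂ))
      (∫ x in Ioi 0, (Complex.exp (-((1 - Complex.exp (Complex.I * u)) * (x : ℝ))) - 1) ∂ρ) := by
  simp only [exp_I_mul_natCast]
  exact hasSum_pow_sub_one_mul_integral_poissonWeight_succ hint (Complex.norm_exp_I_mul_ofReal u).le

lemma ae_pos_of_measure_Iic_eq_zero (hρ : ρ (Iic 0) = 0) : ∀ᵐ x ∂ρ, 0 < x := by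
  rw [ae_iff]
  simpa only [not_lt, ← Iic_def] using hρ

lemma sFinite_of_lintegral_lt_top {α : Type*} [MeasurableSpace α] {μ : Measure α}
    {f : α → ℝ≥0∞} (hf : Measurable f) (h0 : ∀ᵐ a ∂μ, f a ≠ 0) (hint : ∫⁻ a, f a ∂μ < ∞) :
    SFinite μ := by
  have := isFiniteMeasure_withDensity hint.ne
  rw [← withDensity_inv_same hf h0 ((ae_lt_top hf hint.ne).mono fun _ h => h.ne)]
  infer_instance

lemma sFinite_of_lintegral_min_one_lt_top (hpos : ρ (Iic 0) = 0)
    (hint : ∫⁻ x, ENNReal.ofReal (min 1 x) ∂ρ < ∞) : SFinite ρ := by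
  refine sFinite_of_lintegral_lt_top (by fun_prop) ?_ hint
  filter_upwards [ae_pos_of_measure_Iic_eq_zero hpos] with x hx
  exact (ENNReal.ofReal_pos.2 (lt_min one_pos hx)).ne'

lemma IsMixedPoissonProcess.integral_exp_eq_exp_tsum [IsProbabilityMeasure P] [SFinite G₀]
    (h : IsMixedPoissonProcess P G X) (hG : IsCompletelyRandomMeasure P G (ρ.prod G₀))
    (hpos : ρ (Iic 0) = 0) (hint : ∫⁻ x, ENNReal.ofReal (min 1 x) ∂ρ < ∞)
    {A : Set Ω} (hA : MeasurableSet A) (u : ℝ) :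
    ∫ s, Complex.exp (Complex.I * u * (X s A).toReal) ∂P =
      Complex.exp ((G₀ A).toReal * ∑' m : ℕ, (Complex.exp (Complex.I * u * (m + 1 : ℕ)) - 1) *
        ((∫ x in Ioi 0, poissonWeight (m + 1) x ∂ρ : ℝ) : ℂ)) := by
  have := sFinite_of_lintegral_min_one_lt_top hpos hint
  have hrestrict : ρ.restrict (Ioi 0) = ρ :=
    Measure.restrict_eq_self_of_ae_mem (ae_pos_of_measure_Iic_eq_zero hpos)
  have hre : 0 ≤ (1 - Complex.exp (Complex.I * u)).re := by
    rw [Complex.sub_re, Complex.one_re, sub_nonneg, ← Complex.norm_exp_I_mul_ofReal u]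
    exact Complex.re_le_norm _
  rw [h.integral_exp_eq hA, hG.integral_exp_neg_mul hA hre,
    setIntegral_univ_prod_fst ρ G₀ A
      fun x => Complex.exp (-((1 - Complex.exp (Complex.I * u)) * x)) - 1,
    (hasSum_exp_sub_one_mul_integral_poissonWeight_succ hint u).tsum_eq,
    hrestrict]

theorem IsMixedPoissonProcess.isCompletelyRandomMeasure [IsProbabilityMeasure P]
    [IsFiniteMeasure G₀] (h : IsMixedPoissonProcess P G X)
    (hG : IsCompletelyRandomMeasure P G (ρ.prod G₀)) (hpos : ρ (Iic 0) = 0)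
    (hint : ∫⁻ x, ENNReal.ofReal (min 1 x) ∂ρ < ∞) :
    IsCompletelyRandomMeasure P X (mixtureLevyMeasure ρ G₀) where
  measurable := h.measurable
  ae_finite := h.ae_lt_top
  isLevyMeasure := isLevyMeasure_mixtureLevyMeasure G₀ hint
  indep _ A hA hdisj := h.iIndepFun_apply hA hdisj (hG.indep _ A hA hdisj)
  charFun_eq A hA u := by
    rw [h.integral_exp_eq_exp_tsum hG hpos hint hA u]
    exact congrArg Complex.exp (setIntegral_mixtureLevyMeasure G₀ hint A
      (f := fun x => Complex.exp (Complex.I * u * x) - 1) (by fun_prop)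
      (norm_exp_I_mul_mul_sub_one_le u)).symm

end MixedCompletelyRandomMeasure

end CountMixture

theorem mainTheorem2 {S Ω : Type*} [MeasurableSpace S] [MeasurableSpace Ω]
    (P : Measure S) [IsProbabilityMeasure P]
    (ρ : Measure ℝ) (hρ_pos : ρ (Iic 0) = 0)
    (hρ_int : ∫⁻ x, ENNReal.ofReal (min 1 x) ∂ρ < ∞)
    (G₀ : Measure Ω) [IsFiniteMeasure G₀]
    (K : S → ℕ∞) (r : ℕ → S → ℝ≥0) (ω : ℕ → S → Ω) (n : ℕ → S → ℕ)
    (hmodel : CountMixture.IsCountMixture P ρ G₀ K r ω n)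
    (X : S → Measure Ω)
    (hX : X = CountMixture.atomicMeasure K (fun k s => (n k s : ℝ≥0)) ω) :
    CountMixture.IsMixedPoissonProcess P (CountMixture.atomicMeasure K r ω) X ∧
    (∀ m : ℕ, IntegrableOn
      (fun x : ℝ => x ^ (m + 1) * Real.exp (-x) / (m + 1).factorial) (Ioi 0) ρ) ∧
    (∀ u : ℝ, Summable fun m : ℕ =>
      (Complex.exp (Complex.I * u * (m + 1 : ℕ)) - 1) *
        ((∫ x in Ioi 0, x ^ (m + 1) * Real.exp (-x) / (m + 1).factorial ∂ρ : ℝ) : ℂ)) ∧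
    (∀ A : Set Ω, MeasurableSet A → ∀ u : ℝ,
      ∫ s, Complex.exp (Complex.I * u * (X s A).toReal) ∂P =
        Complex.exp ((G₀ A).toReal * ∑' m : ℕ,
          (Complex.exp (Complex.I * u * (m + 1 : ℕ)) - 1) *
            ((∫ x in Ioi 0, x ^ (m + 1) * Real.exp (-x) / (m + 1).factorial ∂ρ : ℝ) : ℂ))) ∧
    CountMixture.IsCompletelyRandomMeasure P X (CountMixture.mixtureLevyMeasure ρ G₀) := by
  subst hX
  have hmixed := hmodel.isMixedPoissonProcess
  exact ⟨hmixed,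
    CountMixture.integrableOn_poissonWeight_succ hρ_int,
    fun u =>
      (CountMixture.hasSum_exp_sub_one_mul_integral_poissonWeight_succ hρ_int u).summable,
    fun _ hA u => hmixed.integral_exp_eq_exp_tsum hmodel.crm hρ_pos hρ_int hA u,
    hmixed.isCompletelyRandomMeasure hmodel.crm hρ_pos hρ_int⟩
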